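/- Let $\mathbb{S}^m$ be the space of real symmetric $m\times m$ matrices with $A\bullet B=\mathrm{Tr}(AB)$ and $\|A\|_F^2=\mathrm{Tr}(A^2)$, and consider the problem $$\min f_0(x)\quad\text{subject to}\quad G(x)\preceq 0,\quad h(x)=0,\qquad x\in\mathbb{R}^d,$$ where $f_0:\mathbb{R}^d\to\mathbb{R}$, $G:\mathbb{R}^d\to\mathbb{S}^m$, $h:\mathbb{R}^d\to\mathbb{R}^l$ and $\preceq 0$ means negative semidefinite. Let $f^*$ be its optimal value and let $\Omega^*$ be the set of its globally optimal solutions; assume $\Omega^*\neq\emptyset$. Multipliers $\lambda=(\mu,\nu)$ and parameters $p=(q,w)$ range over $\Lambda=P=\mathbb{S}^m\times\mathbb{R}^l$. Put $\langle\lambda,p\rangle=\mu\bullet q+\nu^Tw$ and $\sigma(p)=\tfrac12\|q\|_F^2+\tfrac12\|w\|^2$. Let $\Phi(x,p)=f_0(x)$ if $G(x)+q\preceq 0$ and $h(x)+w=0$, and $\Phi(x,p)=+\infty$ otherwise; let $v(p)=\inf_{x}\Phi(x,p)$. The augmented Lagrangian is $$\mathscr{L}(x,\lambda,r)=\inf_{p\in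 P}\big(\Phi(x,p)-\langle\lambda,p\rangle+r\sigma(p)\big),$$ which for $r>0$ equals $f_0(x)+\frac1{2r}\big(\mathrm{Tr}([rG(x)+\mu]_+^2)-\mathrm{Tr}(\mu^2)\big)+\nu^Th(x)+\frac r2\|h(x)\|^2$, where $[\cdot]_+$ is the projection onto the cone of positive semidefinite matrices. A multiplier $\lambda$ is an augmented Lagrange multiplier of the problem if there is $r\ge 0$ such that $v(p)\ge v(0)+\langle\lambda,p\rangle-r\sigma(p)$ for all $p\in P$. Let $L(x,\lambda)=f_0(x)+\mu\bullet G(x)+\nu^Th(x)$. The pair $(x^*,\lambda^*)$ with $\lambda^*=(\mu^*,\nu^*)$ is a KKT pair if $\mu^*$ is positive semidefinite, $\mu^*G(x^*)=0$ and $D_xL(x^*,\lambda^*)=0$. It satisfies the second order sufficient optimality condition if the matrix $$D^2_{xx}L(x^*,\lambda^*)-2\Big[\mu^*\bullet\big(D_{x_i}G(x^*)\,G(x^*)^{\dagger}\,D_{x_j}G(x^*)\big)\Big]_{i,j=1}^d$$ is positive definite on the cone $$C(x^*)=\Big\{v\in\mathbb{R}^d \;\Big|\; \sum_{i=1}^d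 v_iE_0^TD_{x_i}G(x^*)E_0\preceq 0,\ \nabla h(x^*)v=0,\ \nabla f_0(x^*)^Tv=0\Big\},$$ where $G(x^*)^\dagger$ is the Moore–Penrose pseudoinverse and the columns of $E_0$ are orthonormal eigenvectors of $G(x^*)$ spanning its null space (if $G(x^*)$ is invertible, then $E_0$ has no columns, the first condition in $C(x^*)$ is void, and $\mu^*=0$ for every KKT pair). **Theorem.** Let $f_0$ be lower semicontinuous, let $G$ and $h$ be continuous, and let $f_0$, $G$, $h$ be twice differentiable at every $x^*\in\Omega^*$. Let $\lambda^*\in\Lambda$ be such that for every $x^*\in\Omega^*$ the pair $(x^*,\lambda^*)$ is a KKT pair satisfying the second order sufficient optimality condition. Then $\lambda^*$ is an augmented Lagrange multiplier of the problem if and only if there exist $r_0>0$ and $\delta>0$ such that the function $\mathscr{L}(\cdot,\lambda^*,r_0)$ is bounded below on $\mathbb{R}^d$ and the set $$\big\{x\in\mathbb{R}^d \;\big|\; \mathscr{L}(x,\lambda^*,r_0)<f^*,\ \mathrm{Tr}([G(x)]_+^2)+\|h(x)\|^2<\delta\big\}$$ is bounded or empty. -/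

import Mathlib

open Filter Topology
open scoped Matrix

namespace NSDP

noncomputable section

/-! ### Real symmetric matrices -/

/-- The space `𝕊^m` of real symmetric `m × m` matrices. -/
def SymMat (m : ℕ) : Submodule ℝ (Matrix (Fin m) (Fin m) ℝ) where
  carrier := {A | Aᵀ = A}
  add_mem' := by
    intro A B hA hB
    simp only [Set.mem_ofPred_eq] at *
    rw [Matrix.transpose_add, hA, hB]
  zero_mem' := Matrix.transpose_zero
  smul_mem' := by
    intro c A hA
    simp only [Set.mem_ofPred_eq] at *
    rw [Matrix.transpose_smul, hA]

theorem isHermitian {m : ℕ} (A : SymMat m) :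
    (A : Matrix (Fin m) (Fin m) ℝ).IsHermitian := by
  have h : (A : Matrix (Fin m) (Fin m) ℝ)ᵀ = A := A.2
  unfold Matrix.IsHermitian
  rw [Matrix.conjTranspose_eq_transpose_of_trivial, h]

/-- `M ⪯ 0`: the matrix `M` is (symmetric and) negative semidefinite. -/
def NegSemidef {n : Type*} (M : Matrix n n ℝ) : Prop := (-M).PosSemidef

/-- The inner product `A • B = Tr (A B)`. -/
def frobInner {m : ℕ} (A B : Matrix (Fin m) (Fin m) ℝ) : ℝ := (A * B).trace

/-- The orthogonal matrix whose columns are the eigenvectors of `A`. -/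
def eigMat {m : ℕ} (A : SymMat m) : Matrix (Fin m) (Fin m) ℝ :=
  ((isHermitian A).eigenvectorUnitary : Matrix (Fin m) (Fin m) ℝ)

/-- `f (A) = U diag (f (λ₁), …, f (λ_m)) Uᵀ`, where `A = U diag (λ₁, …, λ_m) Uᵀ`. -/
def spectralMap {m : ℕ} (f : ℝ → ℝ) (A : SymMat m) : Matrix (Fin m) (Fin m) ℝ :=
  eigMat A * Matrix.diagonal (fun k => f ((isHermitian A).eigenvalues k)) * (eigMat A)ᵀ

/-- `[A]₊`, the projection of `A` onto the cone of positive semidefinite matrices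
(see `posProj_posSemidef` and `posProj_nearest`). -/
def posProj {m : ℕ} (A : SymMat m) : Matrix (Fin m) (Fin m) ℝ :=
  spectralMap (fun t => max t 0) A

/-- The Moore-Penrose pseudoinverse `A†`; the eigenvalue `0` is kept, since `0⁻¹ = 0` here
(see `pinv_penrose` and `pinv_unique`). -/
def pinv {m : ℕ} (A : SymMat m) : Matrix (Fin m) (Fin m) ℝ :=
  spectralMap (fun t => t⁻¹) A

/-- The matrix `E₀` whose columns are the (orthonormal) eigenvectors of `A` that correspond to
the eigenvalue `0`. -/
def nullEigMat {m : ℕ} (A : SymMat m) :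
    Matrix (Fin m) {k : Fin m // (isHermitian A).eigenvalues k = 0} ℝ :=
  (eigMat A).submatrix id Subtype.val

theorem eigMat_transpose_mul {m : ℕ} (A : SymMat m) : (eigMat A)ᵀ * eigMat A = 1 := by
  have h := Unitary.coe_star_mul_self (isHermitian A).eigenvectorUnitary
  rwa [Matrix.star_eq_conjTranspose, Matrix.conjTranspose_eq_transpose_of_trivial] at h

theorem spectralMap_id {m : ℕ} (A : SymMat m) :
    spectralMap (fun t => t) A = (A : Matrix (Fin m) (Fin m) ℝ) := by
  have h := (isHermitian A).spectral_theorem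
  rw [Unitary.conjStarAlgAut_apply, Matrix.star_eq_conjTranspose,
    Matrix.conjTranspose_eq_transpose_of_trivial] at h
  exact h.symm

theorem spectralMap_mul {m : ℕ} (f g : ℝ → ℝ) (A : SymMat m) :
    spectralMap f A * spectralMap g A = spectralMap (fun t => f t * g t) A := by
  have h : spectralMap f A * spectralMap g A
      = eigMat A * (Matrix.diagonal (fun k => f ((isHermitian A).eigenvalues k))
        * ((eigMat A)ᵀ * eigMat A)
        * Matrix.diagonal (fun k => g ((isHermitian A).eigenvalues k))) * (eigMat A)ᵀ := by
    simp only [spectralMap, Matrix.mul_assoc]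
  rw [h, eigMat_transpose_mul, Matrix.mul_one, Matrix.diagonal_mul_diagonal]
  rfl

theorem spectralMap_sub {m : ℕ} (f g : ℝ → ℝ) (A : SymMat m) :
    spectralMap f A - spectralMap g A = spectralMap (fun t => f t - g t) A := by
  simp only [spectralMap]
  rw [← Matrix.sub_mul, ← Matrix.mul_sub, Matrix.diagonal_sub]

theorem spectralMap_transpose {m : ℕ} (f : ℝ → ℝ) (A : SymMat m) :
    (spectralMap f A)ᵀ = spectralMap f A := by
  simp only [spectralMap, Matrix.transpose_mul, Matrix.transpose_transpose,
    Matrix.diagonal_transpose, Matrix.mul_assoc]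

theorem spectralMap_posSemidef {m : ℕ} {f : ℝ → ℝ} (hf : ∀ t, 0 ≤ f t) (A : SymMat m) :
    (spectralMap f A).PosSemidef := by
  have h : (Matrix.diagonal (fun k => f ((isHermitian A).eigenvalues k))).PosSemidef :=
    Matrix.PosSemidef.diagonal (fun k => hf _)
  have h2 := h.mul_mul_conjTranspose_same (eigMat A)
  rwa [Matrix.conjTranspose_eq_transpose_of_trivial] at h2

theorem posProj_posSemidef {m : ℕ} (A : SymMat m) : (posProj A).PosSemidef :=
  spectralMap_posSemidef (fun _ => le_max_right _ _) A

open scoped MatrixOrder Matrix.Norms.L2Operator in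
theorem trace_mul_nonneg {m : ℕ} {B C : Matrix (Fin m) (Fin m) ℝ}
    (hB : B.PosSemidef) (hC : C.PosSemidef) : 0 ≤ (B * C).trace := by
  obtain ⟨S, rfl⟩ := CStarAlgebra.nonneg_iff_eq_star_mul_self.mp hC.nonneg
  rw [Matrix.star_eq_conjTranspose, ← Matrix.mul_assoc, Matrix.trace_mul_comm, ← Matrix.mul_assoc]
  exact (hB.mul_mul_conjTranspose_same S).trace_nonneg

/-- `[A]₊` is the positive semidefinite matrix that is nearest to `A` in the Frobenius norm,
and it is the only one. -/
theorem posProj_nearest {m : ℕ} (A : SymMat m) (B : Matrix (Fin m) (Fin m) ℝ)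
    (hB : B.PosSemidef) :
    frobInner ((A : Matrix (Fin m) (Fin m) ℝ) - posProj A)
        ((A : Matrix (Fin m) (Fin m) ℝ) - posProj A)
      + frobInner (B - posProj A) (B - posProj A)
    ≤ frobInner ((A : Matrix (Fin m) (Fin m) ℝ) - B) ((A : Matrix (Fin m) (Fin m) ℝ) - B) := by
  set N := spectralMap (fun t => max t 0 - t) A with hN
  have hAN : (A : Matrix (Fin m) (Fin m) ℝ) = posProj A - N := by
    rw [hN, posProj, spectralMap_sub]
    simp only [sub_sub_cancel]
    exact (spectralMap_id A).symm
  have hNpos : N.PosSemidef :=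
    spectralMap_posSemidef (fun t => sub_nonneg.2 (le_max_left _ _)) A
  have hPN : posProj A * N = 0 := by
    rw [hN, posProj, spectralMap_mul]
    have : (fun t : ℝ => max t 0 * (max t 0 - t)) = fun _ => 0 := by
      funext t
      rcases le_total t 0 with h | h
      · simp [max_eq_right h]
      · simp [max_eq_left h]
    rw [this]
    simp [spectralMap]
  have hBN := trace_mul_nonneg hB hNpos
  have hNP : (N * posProj A).trace = 0 := by rw [Matrix.trace_mul_comm, hPN, Matrix.trace_zero]
  have hNB : (N * B).trace = (B * N).trace := Matrix.trace_mul_comm _ _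
  have hPN' : (posProj A * N).trace = 0 := by rw [hPN, Matrix.trace_zero]
  generalize posProj A = Q at *
  rw [hAN]
  simp only [frobInner, Matrix.sub_mul, Matrix.mul_sub, Matrix.trace_sub]
  linarith

/-- The four Penrose equations. -/
theorem pinv_penrose {m : ℕ} (A : SymMat m) :
    (A : Matrix (Fin m) (Fin m) ℝ) * pinv A * A = A ∧
    pinv A * A * pinv A = pinv A ∧
    ((A : Matrix (Fin m) (Fin m) ℝ) * pinv A)ᵀ = (A : Matrix (Fin m) (Fin m) ℝ) * pinv A ∧
    (pinv A * (A : Matrix (Fin m) (Fin m) ℝ))ᵀ = pinv A * (A : Matrix (Fin m) (Fin m) ℝ) := by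
  rw [← spectralMap_id A]
  simp only [pinv, spectralMap_mul, spectralMap_transpose, mul_inv_mul_cancel, and_true, true_and]
  congr 1
  funext t
  simpa using mul_inv_mul_cancel t⁻¹

/-- The Penrose equations determine the pseudoinverse. -/
theorem pinv_unique {m : ℕ} (A : SymMat m) (X : Matrix (Fin m) (Fin m) ℝ)
    (h1 : (A : Matrix (Fin m) (Fin m) ℝ) * X * A = A) (h2 : X * A * X = X)
    (h3 : ((A : Matrix (Fin m) (Fin m) ℝ) * X)ᵀ = (A : Matrix (Fin m) (Fin m) ℝ) * X)
    (h4 : (X * (A : Matrix (Fin m) (Fin m) ℝ))ᵀ = X * (A : Matrix (Fin m) (Fin m) ℝ)) :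
    X = pinv A := by
  obtain ⟨p1, p2, p3, p4⟩ := pinv_penrose A
  generalize pinv A = Y at *
  generalize (A : Matrix (Fin m) (Fin m) ℝ) = M at *
  have e1 : M * X = M * Y := by
    have : (M * Y) * (M * X) = M * X := by rw [← Matrix.mul_assoc, p1]
    have h := congrArg Matrix.transpose this
    rw [Matrix.transpose_mul, h3, p3, ← Matrix.mul_assoc, h1] at h
    exact h.symm
  have e2 : X * M = Y * M := by
    have : (X * M) * (Y * M) = X * M := by rw [Matrix.mul_assoc, ← Matrix.mul_assoc M, p1]
    have h := congrArg Matrix.transpose this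
    rw [Matrix.transpose_mul, h4, p4, Matrix.mul_assoc, ← Matrix.mul_assoc M, h1] at h
    exact h.symm
  rw [← h2, e2, Matrix.mul_assoc, e1, ← Matrix.mul_assoc, p2]

/-! ### Twice differentiability -/

/-- `f` is twice (Fréchet) differentiable at the point `x`. -/
def TwiceDiffAt {E F : Type*} [NormedAddCommGroup E] [NormedSpace ℝ E]
    [NormedAddCommGroup F] [NormedSpace ℝ F] (f : E → F) (x : E) : Prop :=
  (∀ᶠ y in 𝓝 x, DifferentiableAt ℝ f y) ∧ DifferentiableAt ℝ (fderiv ℝ f) x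

/-- The Hessian matrix of `f` at `x`. -/
def hessian {d : ℕ} (f : EuclideanSpace ℝ (Fin d) → ℝ) (x : EuclideanSpace ℝ (Fin d)) :
    Matrix (Fin d) (Fin d) ℝ :=
  Matrix.of fun i j =>
    fderiv ℝ (fderiv ℝ f) x (EuclideanSpace.single i 1) (EuclideanSpace.single j 1)

/-! ### The nonlinear semidefinite programming problem -/

/-- The data of the problem: minimize `f₀ x` subject to `G x ⪯ 0` and `h x = 0`. -/
structure Problem (d m l : ℕ) where
  /-- the objective function -/
  f₀ : EuclideanSpace ℝ (Fin d) → ℝ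
  /-- the matrix constraint -/
  G : EuclideanSpace ℝ (Fin d) → SymMat m
  /-- the equality constraints -/
  h : EuclideanSpace ℝ (Fin d) → EuclideanSpace ℝ (Fin l)

/-- The space `𝕊^m × ℝ^l` of multipliers `λ = (μ, ν)` and also of parameters `p = (q, w)`. -/
abbrev Param (m l : ℕ) : Type := SymMat m × EuclideanSpace ℝ (Fin l)

/-- The coupling `⟨λ, p⟩ = μ • q + νᵀ w`. -/
def coupling {m l : ℕ} (lam p : Param m l) : ℝ :=
  frobInner lam.1.1 p.1.1 + inner ℝ lam.2 p.2

/-- The augmenting function `σ (p) = ‖q‖_F² / 2 + ‖w‖² / 2`. -/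
def augmenting {m l : ℕ} (p : Param m l) : ℝ :=
  1 / 2 * frobInner p.1.1 p.1.1 + 1 / 2 * ‖p.2‖ ^ 2

namespace Problem

variable {d m l : ℕ} (P : Problem d m l)

/-- The feasible set. -/
def feasible : Set (EuclideanSpace ℝ (Fin d)) :=
  {x | NegSemidef (P.G x : Matrix (Fin m) (Fin m) ℝ) ∧ P.h x = 0}

/-- The set `Ω*` of globally optimal solutions. -/
def solutions : Set (EuclideanSpace ℝ (Fin d)) :=
  {x | x ∈ P.feasible ∧ ∀ y ∈ P.feasible, P.f₀ x ≤ P.f₀ y}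

/-- The optimal value `f*`. -/
def optimalValue : EReal := ⨅ x ∈ P.feasible, (P.f₀ x : EReal)

open Classical in
/-- The dualizing parameterization: `Φ (x, p) = f₀ x` if `G x + q ⪯ 0` and `h x + w = 0`, and
`Φ (x, p) = +∞` otherwise. -/
def dualizing (x : EuclideanSpace ℝ (Fin d)) (p : Param m l) : EReal :=
  if NegSemidef ((P.G x : Matrix (Fin m) (Fin m) ℝ) + (p.1 : Matrix (Fin m) (Fin m) ℝ))
      ∧ P.h x + p.2 = 0
  then (P.f₀ x : EReal) else ⊤

/-- The optimal value function (perturbation function) `v (p) = inf_x Φ (x, p)`. -/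
def perturbation (p : Param m l) : EReal := ⨅ x, P.dualizing x p

/-- The augmented Lagrangian `ℒ (x, λ, r) = inf_p (Φ (x, p) - ⟨λ, p⟩ + r σ (p))`. -/
def augLagrangian (x : EuclideanSpace ℝ (Fin d)) (lam : Param m l) (r : ℝ) : EReal :=
  ⨅ p : Param m l, (P.dualizing x p - (coupling lam p : EReal) + ((r * augmenting p : ℝ) : EReal))

/-- `λ` is an augmented Lagrange multiplier: for some `r ≥ 0` the inequality
`v (p) ≥ v (0) + ⟨λ, p⟩ - r σ (p)` holds for all `p`. -/
def IsAugLagrangeMultiplier (lam : Param m l) : Prop :=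
  ∃ r : ℝ, 0 ≤ r ∧ ∀ p : Param m l,
    P.perturbation 0 + ((coupling lam p - r * augmenting p : ℝ) : EReal) ≤ P.perturbation p

/-- The classical Lagrangian `L (x, λ) = f₀ x + μ • G x + νᵀ h x`. -/
def lagrangian (x : EuclideanSpace ℝ (Fin d)) (lam : Param m l) : ℝ :=
  P.f₀ x + frobInner lam.1.1 (P.G x).1 + inner ℝ lam.2 (P.h x)

/-- `(x, λ)` is a KKT pair. -/
def IsKKTPair (x : EuclideanSpace ℝ (Fin d)) (lam : Param m l) : Prop :=
  (lam.1 : Matrix (Fin m) (Fin m) ℝ).PosSemidef ∧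
  (lam.1 : Matrix (Fin m) (Fin m) ℝ) * (P.G x : Matrix (Fin m) (Fin m) ℝ) = 0 ∧
  fderiv ℝ (fun y => P.lagrangian y lam) x = 0

/-- The functions `f₀`, `G` (entrywise) and `h` are twice differentiable at `x`. -/
def TwiceDiffAt (x : EuclideanSpace ℝ (Fin d)) : Prop :=
  NSDP.TwiceDiffAt P.f₀ x ∧
  (∀ a b, NSDP.TwiceDiffAt (fun y => (P.G y : Matrix (Fin m) (Fin m) ℝ) a b) x) ∧
  NSDP.TwiceDiffAt P.h x

/-- The partial derivative `D_{x_i} G (x)`, an `m × m` matrix. -/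
def partialG (x : EuclideanSpace ℝ (Fin d)) (i : Fin d) : Matrix (Fin m) (Fin m) ℝ :=
  Matrix.of fun a b =>
    fderiv ℝ (fun y => (P.G y : Matrix (Fin m) (Fin m) ℝ) a b) x (EuclideanSpace.single i 1)

/-- The sigma term `-2 [μ • (D_{x_i} G (x) G (x)† D_{x_j} G (x))]_{i, j}`. -/
def sigmaTerm (x : EuclideanSpace ℝ (Fin d)) (lam : Param m l) : Matrix (Fin d) (Fin d) ℝ :=
  Matrix.of fun i j => -2 * frobInner lam.1.1 (P.partialG x i * pinv (P.G x) * P.partialG x j)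

/-- The cone `C (x)`: all `v` with `∑ i, v_i E₀ᵀ D_{x_i} G (x) E₀ ⪯ 0`, `∇h (x) v = 0` and
`∇f₀ (x)ᵀ v = 0`. If `G x` is invertible, then `E₀` has no columns and the first condition
disappears. -/
def criticalCone (x : EuclideanSpace ℝ (Fin d)) : Set (EuclideanSpace ℝ (Fin d)) :=
  {v | NegSemidef (∑ i, v i • ((nullEigMat (P.G x))ᵀ * P.partialG x i * nullEigMat (P.G x))) ∧
    fderiv ℝ P.h x v = 0 ∧ fderiv ℝ P.f₀ x v = 0}

/-- The second order sufficient optimality condition at `(x, λ)`: the matrix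
`D²_{xx} L (x, λ) - 2 [μ • (D_{x_i} G (x) G (x)† D_{x_j} G (x))]_{i, j}` is positive definite on
the cone `C (x)`. If `(x, λ)` is a KKT pair and `G x` is invertible, then `μ = 0`, and this is the
second order condition for the problem of minimizing `f₀` subject to `h = 0`. -/
def SecondOrderSufficient (x : EuclideanSpace ℝ (Fin d)) (lam : Param m l) : Prop :=
  ∀ v ∈ P.criticalCone x, v ≠ 0 →
    0 < v.ofLp ⬝ᵥ ((hessian (fun y => P.lagrangian y lam) x + P.sigmaTerm x lam) *ᵥ v.ofLp)

/-- The penalty term `φ (x) = Tr ([G x]₊²) + ‖h x‖²`. -/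
def penalty (x : EuclideanSpace ℝ (Fin d)) : ℝ :=
  (posProj (P.G x) * posProj (P.G x)).trace + ‖P.h x‖ ^ 2

end Problem

end

end NSDP

/-!
Write `augTerm` for the real number `f₀ x + μ • Y + νᵀ h x + (r / 2) (‖Y‖² + ‖h x‖²)`. Then
`ℒ (x, λ, r)` is the infimum of `augTerm` over all `Y ⪰ G x`, and `λ` is an augmented Lagrange
multiplier exactly when some `r` makes all these numbers at least `f*`
(`isAugLagrangeMultiplier_iff`). Since `augTerm` increases with `r`, a multiplier gives, for all
larger `r`, a lower bound on `ℒ` and an empty sublevel set.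

Conversely, if no `r` works, there are `r n → ∞`, points `x n` and `Y n ⪰ G (x n)` at which
`augTerm` is less than `f*`. The lower bound at `r₀` forces `‖Y n‖² + ‖h (x n)‖² → 0`; this
dominates the penalty term, because `[A]₊` realizes the distance from `A` to the negative
semidefinite cone (`trace_posProj_sq_le`). So `x n` is eventually in the bounded set, and along a
subsequence it converges to a point `a`, which is optimal by lower semicontinuity
(`mem_solutions_of_tendsto`).

This is excluded by the second order condition at `a` (`eq_zero_of_descent_direction`). Put
`t = ‖x n - a‖` and let `v` be a limit of the directions `(x n - a) / t`. The Lagrangian is critical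
at `a`, so it contributes `(t² / 2) D²L (v, v) + o (t²)`, while the other terms of `augTerm`, namely
`μ • (Y n - G (x n))` and the penalty terms, are nonnegative. Hence `Y n` and `h (x n)` are `o (t)`
and `μ • (Y n - G (x n))` is `O (t²)`, which puts `v` into the critical cone. The matrix
`Y n - G (x n) = -G a - t G'(a) v + o (t)` is positive semidefinite and `μ` annihilates `G a`; by a
Schur complement argument (`schur_estimate`) its product with `μ` is at least
`-t² μ • (G'(a) v G(a)† G'(a) v) + o (t²)`. Dividing by `t²`, the quadratic form of the second order
condition is nonpositive at the unit vector `v` of the critical cone.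
-/

namespace NSDP

/-! ### Second order calculus -/

namespace TwiceDiffAt

variable {E F F' : Type*} [NormedAddCommGroup E] [NormedSpace ℝ E]
  [NormedAddCommGroup F] [NormedSpace ℝ F] [NormedAddCommGroup F'] [NormedSpace ℝ F']
  {f g : E → F} {x : E}

theorem differentiableAt (hf : TwiceDiffAt f x) : DifferentiableAt ℝ f x :=
  hf.1.self_of_nhds

theorem const (c : F) : TwiceDiffAt (fun _ : E => c) x := by
  refine ⟨.of_forall fun _ => differentiableAt_const c, ?_⟩
  have h : fderiv ℝ (fun _ : E => c) = fun _ => 0 := by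
    funext y
    exact fderiv_const_apply c
  rw [h]
  exact differentiableAt_const 0

theorem add (hf : TwiceDiffAt f x) (hg : TwiceDiffAt g x) :
    TwiceDiffAt (fun y => f y + g y) x := by
  refine ⟨?_, (hf.2.add hg.2).congr_of_eventuallyEq ?_⟩
  · filter_upwards [hf.1, hg.1] with y h1 h2 using h1.add h2
  · filter_upwards [hf.1, hg.1] with y h1 h2 using fderiv_add h1 h2

theorem clm_comp (hf : TwiceDiffAt f x) (φ : F →L[ℝ] F') :
    TwiceDiffAt (fun y => φ (f y)) x := by
  refine ⟨?_, (((ContinuousLinearMap.compL ℝ E F F') φ).differentiableAt.comp x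
    hf.2).congr_of_eventuallyEq ?_⟩
  · filter_upwards [hf.1] with y h1 using φ.differentiableAt.comp y h1
  · filter_upwards [hf.1] with y h1 using
      (φ.hasFDerivAt.comp y h1.hasFDerivAt).fderiv

theorem const_mul {f : E → ℝ} (hf : TwiceDiffAt f x) (c : ℝ) :
    TwiceDiffAt (fun y => c * f y) x :=
  hf.clm_comp (ContinuousLinearMap.mul ℝ ℝ c)

theorem sum {ι : Type*} (s : Finset ι) {f : ι → E → F} (hf : ∀ i ∈ s, TwiceDiffAt (f i) x) :
    TwiceDiffAt (fun y => ∑ i ∈ s, f i y) x := by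
  classical
  induction s using Finset.induction_on with
  | empty => simpa using const (0 : F)
  | insert i s hi ih =>
    simp only [Finset.sum_insert hi]
    exact (hf i (Finset.mem_insert_self i s)).add
      (ih fun j hj => hf j (Finset.mem_insert_of_mem hj))

/-- Taylor expansion with the Peano remainder: mere existence of the second derivative at the
point suffices. -/
theorem isLittleO {f : E → ℝ} (hf : TwiceDiffAt f x) :
    (fun y => f y - f x - fderiv ℝ f x (y - x) - 1 / 2 * fderiv ℝ (fderiv ℝ f) x (y - x) (y - x))
      =o[𝓝 x] fun y => ‖y - x‖ ^ 2 := by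
  set T := fderiv ℝ (fderiv ℝ f) x
  have hsymm : ∀ v w, T v w = T w v := fun v w =>
    second_derivative_symmetric_of_eventually_of_real
      (hf.1.mono fun y hy => hy.hasFDerivAt) hf.2.hasFDerivAt v w
  have hder : ∀ᶠ y in 𝓝 x, HasFDerivAt
      (fun y => f y - f x - fderiv ℝ f x (y - x) - 1 / 2 * T (y - x) (y - x))
      (fderiv ℝ f y - fderiv ℝ f x - T (y - x)) y := by
    filter_upwards [hf.1] with y hy
    have hid : HasFDerivAt (fun y => y - x) (ContinuousLinearMap.id ℝ E) y :=
      (hasFDerivAt_id y).sub_const x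
    have hT := (T.hasFDerivAt.comp y hid).clm_apply hid
    have h := ((hy.hasFDerivAt.sub_const (f x)).sub
      ((fderiv ℝ f x).hasFDerivAt.comp y hid)).sub (hT.const_mul (1 / 2 : ℝ))
    refine h.congr_fderiv ?_
    ext v
    simp [hsymm v y, hsymm v x]
    ring
  have hlo := hf.2.hasFDerivAt.isLittleO
  rw [Asymptotics.isLittleO_iff]
  intro ε hε
  have hsmall := (Asymptotics.isLittleO_iff.1 hlo) hε
  obtain ⟨δ, hδ, hball⟩ := Metric.eventually_nhds_iff_ball.1 (hder.and hsmall)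
  filter_upwards [Metric.ball_mem_nhds x hδ] with y hy
  -- The derivative of the remainder is at most `ε ‖y - x‖` on the ball of radius `‖y - x‖`.
  have hsub : Metric.closedBall x ‖y - x‖ ⊆ Metric.ball x δ :=
    Metric.closedBall_subset_ball (by rwa [← dist_eq_norm])
  have hmv := (convex_closedBall x ‖y - x‖).norm_image_sub_le_of_norm_hasFDerivWithin_le
    (C := ε * ‖y - x‖)
    (fun z hz => (hball z (hsub hz)).1.hasFDerivWithinAt)
    (fun z hz => (hball z (hsub hz)).2.trans
      (mul_le_mul_of_nonneg_left (by rwa [mem_closedBall_iff_norm] at hz) hε.le))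
    (Metric.mem_closedBall_self (norm_nonneg _)) (y := y)
    (by rw [mem_closedBall_iff_norm])
  simp only [sub_self, map_zero, mul_zero, sub_zero] at hmv
  rw [norm_pow, norm_norm]
  calc _ ≤ _ := hmv
    _ = ε * ‖y - x‖ ^ 2 := by ring

end TwiceDiffAt

/-- Let `x n = xs + t n • v n` with `t n → 0` positive and `v n → v`. The first order difference
quotients along such a sequence converge to the derivative in the direction `v`. -/
theorem tendsto_first_order_quotient {E F : Type*} [NormedAddCommGroup E] [NormedSpace ℝ E]
    [NormedAddCommGroup F] [NormedSpace ℝ F] {f : E → F} {xs : E} (hf : DifferentiableAt ℝ f xs)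
    {t : ℕ → ℝ} {v : ℕ → E} {v₀ : E} (ht : ∀ n, 0 < t n) (ht0 : Tendsto t atTop (𝓝 0))
    (hv : Tendsto v atTop (𝓝 v₀)) :
    Tendsto (fun n => (t n)⁻¹ • (f (xs + t n • v n) - f xs)) atTop (𝓝 (fderiv ℝ f xs v₀)) := by
  refine hf.hasFDerivAt.hasFDerivWithinAt (s := Set.univ) |>.lim (l := atTop)
    (c := fun n => (t n)⁻¹) (d := fun n => t n • v n) ?_ (by simp) ?_
  · simpa using ht0.smul hv
  · refine hv.congr fun n => ?_
    rw [smul_smul, inv_mul_cancel₀ (ht n).ne', one_smul]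

/-- The second order difference quotients at a critical point. -/
theorem tendsto_second_order_quotient {E : Type*} [NormedAddCommGroup E] [NormedSpace ℝ E]
    {f : E → ℝ} {xs : E} (hf : TwiceDiffAt f xs) (hcrit : fderiv ℝ f xs = 0)
    {t : ℕ → ℝ} {v : ℕ → E} {v₀ : E} (ht : ∀ n, 0 < t n) (ht0 : Tendsto t atTop (𝓝 0))
    (hv : Tendsto v atTop (𝓝 v₀)) :
    Tendsto (fun n => (f (xs + t n • v n) - f xs) / t n ^ 2) atTop
      (𝓝 (1 / 2 * fderiv ℝ (fderiv ℝ f) xs v₀ v₀)) := by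
  set T := fderiv ℝ (fderiv ℝ f) xs
  have hx : Tendsto (fun n => xs + t n • v n) atTop (𝓝 xs) := by
    simpa using tendsto_const_nhds.add (ht0.smul hv)
  have h := hf.isLittleO.comp_tendsto hx
  simp only [Function.comp_def, add_sub_cancel_left, hcrit, zero_apply,
    sub_zero] at h
  have h2 : (fun n => ‖t n • v n‖ ^ 2) =O[atTop] fun n => t n ^ 2 := by
    refine Asymptotics.IsBigO.pow ?_ 2
    have hb : v =O[atTop] fun _ => (1 : ℝ) := hv.isBigO_one ℝ
    simpa using ((Asymptotics.isBigO_refl t atTop).smul hb).norm_left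
  have h3 := (h.trans_isBigO h2).tendsto_div_nhds_zero
  have h4 : Tendsto (fun n => T (v n) (v n)) atTop (𝓝 (T v₀ v₀)) := by
    have hc : Continuous fun w => T w w := by fun_prop
    exact (hc.tendsto v₀).comp hv
  have h5 := h3.add (h4.const_mul (1 / 2))
  rw [zero_add] at h5
  refine h5.congr fun n => ?_
  have := (ht n).ne'
  simp only [map_smul, smul_apply, smul_eq_mul]
  field_simp
  ring

theorem clm_apply_eq_sum_single {d : ℕ} {F : Type*} [NormedAddCommGroup F] [NormedSpace ℝ F]
    (φ : EuclideanSpace ℝ (Fin d) →L[ℝ] F) (v : EuclideanSpace ℝ (Fin d)) :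
    φ v = ∑ i, v i • φ (EuclideanSpace.single i 1) := by
  conv_lhs => rw [← (EuclideanSpace.basisFun (Fin d) ℝ).sum_repr v]
  simp

/-! ### Symmetric matrices -/

theorem frobInner_self_eq_sum {m : ℕ} (A : SymMat m) :
    frobInner A.1 A.1 = ∑ i, ∑ j, A.1 i j ^ 2 := by
  have hA : ∀ i j, A.1 j i = A.1 i j := fun i j => congrFun (congrFun A.2 i) j
  simp only [frobInner, Matrix.trace, Matrix.diag_apply, Matrix.mul_apply]
  refine Finset.sum_congr rfl fun i _ => Finset.sum_congr rfl fun j _ => ?_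
  rw [hA i j, sq]

theorem frobInner_self_nonneg {m : ℕ} (A : SymMat m) : 0 ≤ frobInner A.1 A.1 := by
  rw [frobInner_self_eq_sum]
  exact Finset.sum_nonneg fun i _ => Finset.sum_nonneg fun j _ => sq_nonneg _

theorem sq_entry_le_frobInner_self {m : ℕ} (A : SymMat m) (i j : Fin m) :
    A.1 i j ^ 2 ≤ frobInner A.1 A.1 := by
  rw [frobInner_self_eq_sum]
  exact (Finset.single_le_sum (f := fun j => A.1 i j ^ 2) (fun j _ => sq_nonneg _)
    (Finset.mem_univ j)).trans (Finset.single_le_sum (f := fun i => ∑ j, A.1 i j ^ 2)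
      (fun i _ => Finset.sum_nonneg fun j _ => sq_nonneg _) (Finset.mem_univ i))

theorem tendsto_zero_of_frobInner_self {m : ℕ} {A : ℕ → SymMat m}
    (h : Tendsto (fun n => frobInner (A n).1 (A n).1) atTop (𝓝 0)) :
    Tendsto (fun n => (A n).1) atTop (𝓝 0) := by
  refine tendsto_pi_nhds.2 fun i => tendsto_pi_nhds.2 fun j => ?_
  have h2 : Tendsto (fun n => (A n).1 i j ^ 2) atTop (𝓝 0) :=
    squeeze_zero (fun n => sq_nonneg _) (fun n => sq_entry_le_frobInner_self (A n) i j) h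
  refine (tendsto_zero_iff_abs_tendsto_zero _).2 ?_
  simpa [Function.comp_def, Real.sqrt_sq_eq_abs] using h2.sqrt

theorem continuous_frobInner_right {m : ℕ} (M : Matrix (Fin m) (Fin m) ℝ) :
    Continuous fun A : Matrix (Fin m) (Fin m) ℝ => frobInner M A := by
  unfold frobInner
  fun_prop

theorem posSemidef_of_tendsto {n : Type*} [Fintype n] {A : ℕ → Matrix n n ℝ} {B : Matrix n n ℝ}
    (hA : ∀ k, (A k).PosSemidef) (h : Tendsto A atTop (𝓝 B)) : B.PosSemidef := by
  refine .of_dotProduct_mulVec_nonneg ?_ fun x => ?_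
  · have hc : Continuous fun M : Matrix n n ℝ => Mᴴ := by fun_prop
    refine tendsto_nhds_unique (((hc.tendsto B).comp h).congr fun k => ?_) h
    exact (hA k).isHermitian
  · have hc : Continuous fun M : Matrix n n ℝ => star x ⬝ᵥ (M *ᵥ x) := by fun_prop
    exact ge_of_tendsto' ((hc.tendsto B).comp h) fun k => (hA k).dotProduct_mulVec_nonneg x

/-- `[A]₊` measures the Frobenius distance from `A` to the negative semidefinite cone. -/
theorem trace_posProj_sq_le {m : ℕ} {A Y : SymMat m} (h : (Y.1 - A.1).PosSemidef) :
    (posProj A * posProj A).trace ≤ frobInner Y.1 Y.1 := by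
  let Q : SymMat m := ⟨posProj A, spectralMap_transpose _ A⟩
  have hQ : Q.1 = posProj A := rfl
  have hAQ : (A : Matrix (Fin m) (Fin m) ℝ) * posProj A = posProj A * posProj A := by
    conv_lhs => rw [← spectralMap_id A]
    rw [posProj, spectralMap_mul, spectralMap_mul]
    congr 1
    funext t
    rcases le_total t 0 with h | h
    · simp [max_eq_right h]
    · simp [max_eq_left h]
  have h1 := trace_mul_nonneg h (posProj_posSemidef A)
  have h2 := frobInner_self_nonneg (Y - Q)
  have h3 : (posProj A * Y.1).trace = (Y.1 * posProj A).trace := Matrix.trace_mul_comm _ _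
  simp only [frobInner, Submodule.coe_sub, hQ, Matrix.sub_mul, Matrix.mul_sub, Matrix.trace_sub,
    hAQ] at h1 h2 ⊢
  linarith

theorem mul_nullEigMat {m : ℕ} (A : SymMat m) : A.1 * nullEigMat A = 0 := by
  have h : A.1 * eigMat A
      = eigMat A * Matrix.diagonal (fun k => (isHermitian A).eigenvalues k) := by
    conv_lhs => rw [← spectralMap_id A]
    rw [spectralMap, Matrix.mul_assoc, eigMat_transpose_mul, Matrix.mul_one]
  ext i k
  have := congrFun (congrFun h i) k.1
  rw [Matrix.mul_diagonal, k.2, mul_zero] at this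
  exact this

theorem pinv_transpose {m : ℕ} (A : SymMat m) : (pinv A)ᵀ = pinv A :=
  spectralMap_transpose _ A

/-- The Schur complement estimate for `-A + t B ⪰ 0` when `M ⪰ 0` annihilates `A`. It says that the
product of `M` with the congruence of `-A + t B` by `1 - t A† D` is nonnegative; the choice of `D`
that is optimal as `t → 0` is the limit of `-B`. -/
theorem schur_estimate {m : ℕ} {A : SymMat m} {M B D : Matrix (Fin m) (Fin m) ℝ}
    (hM : M.PosSemidef) (hMA : M * A.1 = 0) (hD : Dᵀ = D) {t : ℝ}
    (hS : (-A.1 + t • B).PosSemidef) :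
    0 ≤ frobInner M (-A.1 + t • B) - t ^ 2 * (frobInner M (D * pinv A * B)
        + frobInner M (B * pinv A * D) + frobInner M (D * pinv A * D))
      + t ^ 3 * frobInner M (D * pinv A * B * pinv A * D) := by
  have hAM : A.1 * M = 0 := by
    have h := congrArg Matrix.transpose hMA
    have hMt : Mᵀ = M := by
      rw [← Matrix.conjTranspose_eq_transpose_of_trivial]
      exact hM.isHermitian
    rwa [Matrix.transpose_mul, hMt, A.2, Matrix.transpose_zero] at h
  have hP : (1 - t • (pinv A * D))ᴴ = 1 - t • (D * pinv A) := by
    rw [Matrix.conjTranspose_eq_transpose_of_trivial, Matrix.transpose_sub, Matrix.transpose_smul,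
      Matrix.transpose_mul, pinv_transpose, hD, Matrix.transpose_one]
  have hpos := trace_mul_nonneg hM (hS.conjTranspose_mul_mul_same (1 - t • (pinv A * D)))
  have hPAP : ∀ X, pinv A * (A.1 * (pinv A * X)) = pinv A * X := fun X => by
    rw [← Matrix.mul_assoc, ← Matrix.mul_assoc, (pinv_penrose A).2.1]
  have hMAX : ∀ X, M * (A.1 * X) = 0 := fun X => by
    rw [← Matrix.mul_assoc, hMA, Matrix.zero_mul]
  have hDPA : (M * (D * (pinv A * A.1))).trace = 0 := by
    rw [Matrix.trace_mul_comm, Matrix.mul_assoc, Matrix.mul_assoc, hAM, Matrix.mul_zero,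
      Matrix.mul_zero, Matrix.trace_zero]
  rw [hP] at hpos
  simp only [frobInner, Matrix.mul_assoc, Matrix.mul_add, Matrix.add_mul, Matrix.mul_sub,
    Matrix.sub_mul, Matrix.mul_one, Matrix.one_mul, Matrix.mul_neg, Matrix.neg_mul,
    Matrix.mul_smul, Matrix.smul_mul, Matrix.trace_add, Matrix.trace_sub, Matrix.trace_neg,
    Matrix.trace_smul, smul_eq_mul, hMA, hMAX, hPAP, hDPA, Matrix.trace_zero] at hpos ⊢
  linarith

namespace Problem

variable {d m l : ℕ} (P : Problem d m l)

/-! ### The augmented Lagrangian as an infimum of real numbers -/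

/-- The real value `f₀ x + μ • Y + νᵀ h x + (r / 2) (‖Y‖_F² + ‖h x‖²)`. For `Y ⪰ G x` this is the
expression under the infimum defining `ℒ (x, λ, r)`, at the parameter `p = (-Y, -h x)`; at all other
parameters that expression is `+∞`. -/
noncomputable def augTerm (lam : Param m l) (r : ℝ) (x : EuclideanSpace ℝ (Fin d))
    (Y : SymMat m) : ℝ :=
  P.f₀ x + frobInner lam.1.1 Y.1 + inner ℝ lam.2 (P.h x)
    + r / 2 * (frobInner Y.1 Y.1 + ‖P.h x‖ ^ 2)

variable {P}

theorem augTerm_eq_add (lam : Param m l) (r₀ r : ℝ) (x : EuclideanSpace ℝ (Fin d))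
    (Y : SymMat m) : P.augTerm lam r x Y
      = P.augTerm lam r₀ x Y + (r - r₀) / 2 * (frobInner Y.1 Y.1 + ‖P.h x‖ ^ 2) := by
  unfold augTerm
  ring

theorem augTerm_mono {lam : Param m l} {r₀ r : ℝ} (hr : r₀ ≤ r) (x : EuclideanSpace ℝ (Fin d))
    (Y : SymMat m) : P.augTerm lam r₀ x Y ≤ P.augTerm lam r x Y := by
  rw [augTerm_eq_add lam r₀ r]
  have h1 := frobInner_self_nonneg Y
  have : 0 ≤ (r - r₀) / 2 * (frobInner Y.1 Y.1 + ‖P.h x‖ ^ 2) :=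
    mul_nonneg (by linarith) (by positivity)
  linarith

theorem augTerm_eq_param {lam p : Param m l} {r : ℝ} {x : EuclideanSpace ℝ (Fin d)}
    (hp : P.h x + p.2 = 0) :
    P.augTerm lam r x (-p.1) = P.f₀ x - coupling lam p + r * augmenting p := by
  have hh : P.h x = -p.2 := eq_neg_of_add_eq_zero_left hp
  simp only [augTerm, coupling, augmenting, frobInner, hh, Submodule.coe_neg, Matrix.mul_neg,
    Matrix.neg_mul, neg_neg, Matrix.trace_neg, inner_neg_right, norm_neg]
  ring

theorem dualizing_of_mem {x : EuclideanSpace ℝ (Fin d)} {p : Param m l}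
    (h1 : NegSemidef ((P.G x : Matrix (Fin m) (Fin m) ℝ) + (p.1 : Matrix (Fin m) (Fin m) ℝ)))
    (h2 : P.h x + p.2 = 0) : P.dualizing x p = (P.f₀ x : EReal) :=
  if_pos ⟨h1, h2⟩

theorem negSemidef_add_iff {A q : SymMat m} :
    NegSemidef (A.1 + q.1) ↔ ((-q).1 - A.1).PosSemidef := by
  rw [NegSemidef, Submodule.coe_neg, neg_add']
  rw [show -A.1 - q.1 = -q.1 - A.1 by abel]

theorem augLagrangian_lt_iff {lam : Param m l} {r a : ℝ} {x : EuclideanSpace ℝ (Fin d)} :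
    P.augLagrangian x lam r < (a : EReal) ↔
      ∃ Y : SymMat m, (Y.1 - (P.G x).1).PosSemidef ∧ P.augTerm lam r x Y < a := by
  rw [augLagrangian, iInf_lt_iff]
  constructor
  · rintro ⟨p, hp⟩
    by_cases h : NegSemidef ((P.G x : Matrix (Fin m) (Fin m) ℝ)
        + (p.1 : Matrix (Fin m) (Fin m) ℝ)) ∧ P.h x + p.2 = 0
    · refine ⟨-p.1, negSemidef_add_iff.1 h.1, ?_⟩
      rw [dualizing_of_mem h.1 h.2] at hp
      rw [augTerm_eq_param h.2]
      exact_mod_cast hp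
    · rw [dualizing, if_neg h, EReal.top_sub_coe, EReal.top_add_coe] at hp
      exact absurd hp not_top_lt
  · rintro ⟨Y, hY, hlt⟩
    let p : Param m l := (-Y, -P.h x)
    have h1 : NegSemidef ((P.G x).1 + p.1.1) :=
      negSemidef_add_iff.2 (by rw [show -p.1 = Y from neg_neg Y]; exact hY)
    have h2 : P.h x + p.2 = 0 := add_neg_cancel (P.h x)
    refine ⟨p, ?_⟩
    rw [dualizing_of_mem h1 h2]
    have h3 := augTerm_eq_param (lam := lam) (r := r) h2
    rw [show -p.1 = Y from neg_neg Y] at h3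
    rw [h3] at hlt
    exact_mod_cast hlt

theorem le_augLagrangian_iff {lam : Param m l} {r a : ℝ} {x : EuclideanSpace ℝ (Fin d)} :
    (a : EReal) ≤ P.augLagrangian x lam r ↔
      ∀ Y : SymMat m, (Y.1 - (P.G x).1).PosSemidef → a ≤ P.augTerm lam r x Y := by
  rw [← not_lt, augLagrangian_lt_iff]
  push Not
  rfl

theorem optimalValue_eq {x : EuclideanSpace ℝ (Fin d)} (hx : x ∈ P.solutions) :
    P.optimalValue = (P.f₀ x : EReal) := by
  refine le_antisymm (iInf₂_le x hx.1) (le_iInf₂ fun y hy => ?_)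
  exact_mod_cast hx.2 y hy

theorem perturbation_zero {x : EuclideanSpace ℝ (Fin d)} (hx : x ∈ P.solutions) :
    P.perturbation 0 = (P.f₀ x : EReal) := by
  refine le_antisymm ?_ (le_iInf fun y => ?_)
  · refine (iInf_le _ x).trans_eq (dualizing_of_mem ?_ ?_)
    · simpa using hx.1.1
    · simpa using hx.1.2
  · by_cases h : NegSemidef ((P.G y : Matrix (Fin m) (Fin m) ℝ)
        + ((0 : Param m l).1 : Matrix (Fin m) (Fin m) ℝ)) ∧ P.h y + (0 : Param m l).2 = 0
    · rw [dualizing_of_mem h.1 h.2]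
      exact_mod_cast hx.2 y ⟨by simpa using h.1, by simpa using h.2⟩
    · rw [dualizing, if_neg h]
      exact le_top

/-- Augmented Lagrange multipliers are the multipliers for which `ℒ (·, λ, r)` is bounded below by
the optimal value. -/
theorem isAugLagrangeMultiplier_iff {xs : EuclideanSpace ℝ (Fin d)} (hxs : xs ∈ P.solutions)
    {lam : Param m l} : P.IsAugLagrangeMultiplier lam ↔
      ∃ r : ℝ, 0 ≤ r ∧ ∀ x (Y : SymMat m), (Y.1 - (P.G x).1).PosSemidef →
        P.f₀ xs ≤ P.augTerm lam r x Y := by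
  unfold IsAugLagrangeMultiplier
  rw [perturbation_zero hxs]
  refine exists_congr fun r => and_congr_right fun _ => ⟨fun H x Y hY => ?_, fun H p => ?_⟩
  · let p : Param m l := (-Y, -P.h x)
    have h1 : NegSemidef ((P.G x).1 + p.1.1) :=
      negSemidef_add_iff.2 (by rw [show -p.1 = Y from neg_neg Y]; exact hY)
    have h2 : P.h x + p.2 = 0 := add_neg_cancel (P.h x)
    have h3 := augTerm_eq_param (lam := lam) (r := r) h2
    rw [show -p.1 = Y from neg_neg Y] at h3
    have h4 := (H p).trans (iInf_le _ x)
    rw [dualizing_of_mem h1 h2, ← EReal.coe_add, EReal.coe_le_coe_iff] at h4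
    rw [h3]
    linarith
  · refine le_iInf fun x => ?_
    by_cases h : NegSemidef ((P.G x : Matrix (Fin m) (Fin m) ℝ)
        + (p.1 : Matrix (Fin m) (Fin m) ℝ)) ∧ P.h x + p.2 = 0
    · have h4 := H x (-p.1) (negSemidef_add_iff.1 h.1)
      rw [augTerm_eq_param h.2] at h4
      rw [dualizing_of_mem h.1 h.2, ← EReal.coe_add, EReal.coe_le_coe_iff]
      linarith
    · rw [dualizing, if_neg h]
      exact le_top

theorem penalty_le {x : EuclideanSpace ℝ (Fin d)} {Y : SymMat m}
    (h : (Y.1 - (P.G x).1).PosSemidef) :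
    P.penalty x ≤ frobInner Y.1 Y.1 + ‖P.h x‖ ^ 2 :=
  add_le_add_left (trace_posProj_sq_le h) _

/-! ### Derivatives of the Lagrangian -/

theorem twiceDiffAt_lagrangian {x : EuclideanSpace ℝ (Fin d)} (hx : P.TwiceDiffAt x)
    (lam : Param m l) : NSDP.TwiceDiffAt (fun y => P.lagrangian y lam) x := by
  unfold lagrangian
  refine (hx.1.add ?_).add (hx.2.2.clm_comp (innerSL ℝ lam.2))
  simp only [frobInner, Matrix.trace, Matrix.diag_apply, Matrix.mul_apply]
  exact .sum _ fun i _ => .sum _ fun j _ => (hx.2.1 j i).const_mul _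

/-- The derivative of `G` in the direction `v`. -/
noncomputable def dirG (P : Problem d m l) (x v : EuclideanSpace ℝ (Fin d)) :
    Matrix (Fin m) (Fin m) ℝ :=
  ∑ i, v i • P.partialG x i

theorem fderiv_entry (x v : EuclideanSpace ℝ (Fin d)) (a b : Fin m) :
    fderiv ℝ (fun y => (P.G y : Matrix (Fin m) (Fin m) ℝ) a b) x v = P.dirG x v a b := by
  rw [clm_apply_eq_sum_single, dirG, Matrix.sum_apply]
  rfl

theorem dirG_transpose (x v : EuclideanSpace ℝ (Fin d)) : (P.dirG x v)ᵀ = P.dirG x v := by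
  ext a b
  rw [Matrix.transpose_apply, ← fderiv_entry, ← fderiv_entry]
  congr 2
  funext y
  exact congrFun (congrFun (P.G y).2 a) b

/-- The quadratic form of the second order condition. -/
theorem secondOrder_quadForm (x v : EuclideanSpace ℝ (Fin d)) (lam : Param m l) :
    v.ofLp ⬝ᵥ ((hessian (fun y => P.lagrangian y lam) x + P.sigmaTerm x lam) *ᵥ v.ofLp)
      = fderiv ℝ (fderiv ℝ fun y => P.lagrangian y lam) x v v
        - 2 * frobInner lam.1.1 (P.dirG x v * pinv (P.G x) * P.dirG x v) := by
  set T := fderiv ℝ (fderiv ℝ fun y => P.lagrangian y lam) x with hT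
  have h1 : T v v = ∑ i, ∑ j, v i * (v j
      * T (EuclideanSpace.single i 1) (EuclideanSpace.single j 1)) := by
    rw [clm_apply_eq_sum_single T v, sum_apply]
    refine Finset.sum_congr rfl fun i _ => ?_
    rw [smul_apply, clm_apply_eq_sum_single (T (EuclideanSpace.single i 1)) v, smul_eq_mul,
      Finset.mul_sum]
    rfl
  have h2 : frobInner lam.1.1 (P.dirG x v * pinv (P.G x) * P.dirG x v) = ∑ i, ∑ j,
      v i * (v j * frobInner lam.1.1 (P.partialG x i * pinv (P.G x) * P.partialG x j)) := by
    simp only [dirG, frobInner, Finset.sum_mul, Finset.mul_sum, Matrix.trace_sum, Matrix.smul_mul,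
      Matrix.mul_smul, Matrix.trace_smul, smul_eq_mul]
    rw [Finset.sum_comm]
    refine Finset.sum_congr rfl fun i _ => Finset.sum_congr rfl fun j _ => ?_
    ring
  rw [h1, h2]
  simp only [dotProduct, Matrix.mulVec, Matrix.add_apply, hessian, sigmaTerm, Matrix.of_apply,
    Finset.mul_sum, ← Finset.sum_sub_distrib]
  refine Finset.sum_congr rfl fun i _ => Finset.sum_congr rfl fun j _ => ?_
  rw [← hT]
  ring

theorem criticalCone_iff {x v : EuclideanSpace ℝ (Fin d)} : v ∈ P.criticalCone x ↔
    (-((nullEigMat (P.G x))ᵀ * P.dirG x v * nullEigMat (P.G x))).PosSemidef ∧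
      fderiv ℝ P.h x v = 0 ∧ fderiv ℝ P.f₀ x v = 0 := by
  have h : (nullEigMat (P.G x))ᵀ * P.dirG x v * nullEigMat (P.G x)
      = ∑ i, v i • ((nullEigMat (P.G x))ᵀ * P.partialG x i * nullEigMat (P.G x)) := by
    simp only [dirG, Matrix.smul_mul, Matrix.mul_smul, Matrix.mul_sum, Matrix.sum_mul]
  rw [h]
  rfl

/-! ### Absence of local descent -/

theorem augTerm_eq_lagrangian (lam : Param m l) (r : ℝ) (x : EuclideanSpace ℝ (Fin d))
    (Y : SymMat m) : P.augTerm lam r x Y = P.lagrangian x lam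
      + frobInner lam.1.1 (Y.1 - (P.G x).1) + r / 2 * (frobInner Y.1 Y.1 + ‖P.h x‖ ^ 2) := by
  simp only [augTerm, lagrangian, frobInner, Matrix.mul_sub, Matrix.trace_sub]
  ring

theorem lagrangian_eq_of_kkt {xs : EuclideanSpace ℝ (Fin d)} {lam : Param m l}
    (hh : P.h xs = 0) (hkkt : P.IsKKTPair xs lam) : P.lagrangian xs lam = P.f₀ xs := by
  simp [lagrangian, frobInner, hkkt.2.1, hh]

theorem tendsto_G_quotient {xs : EuclideanSpace ℝ (Fin d)} (hd : P.TwiceDiffAt xs)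
    {t : ℕ → ℝ} {v : ℕ → EuclideanSpace ℝ (Fin d)} {v₀ : EuclideanSpace ℝ (Fin d)}
    (ht : ∀ n, 0 < t n) (ht0 : Tendsto t atTop (𝓝 0)) (hv : Tendsto v atTop (𝓝 v₀)) :
    Tendsto (fun n => (t n)⁻¹ • ((P.G (xs + t n • v n)).1 - (P.G xs).1)) atTop
      (𝓝 (P.dirG xs v₀)) := by
  refine tendsto_pi_nhds.2 fun a => tendsto_pi_nhds.2 fun b => ?_
  rw [← fderiv_entry]
  exact tendsto_first_order_quotient (hd.2.1 a b).differentiableAt ht ht0 hv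

/-- If the values `augTerm` along `xs + t n • v n` stay below `f₀ xs` while the penalty parameter
tends to infinity, then `v₀` lies in the critical cone and the quadratic form of the second order
condition is nonpositive at `v₀`, so that `v₀` vanishes. -/
theorem eq_zero_of_descent_direction {xs : EuclideanSpace ℝ (Fin d)} (hxs : P.h xs = 0)
    (hd : P.TwiceDiffAt xs) {lam : Param m l} (hkkt : P.IsKKTPair xs lam)
    (hsosc : P.SecondOrderSufficient xs lam)
    {t : ℕ → ℝ} {v : ℕ → EuclideanSpace ℝ (Fin d)} {v₀ : EuclideanSpace ℝ (Fin d)}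
    {Y : ℕ → SymMat m} {r : ℕ → ℝ}
    (ht : ∀ n, 0 < t n) (ht0 : Tendsto t atTop (𝓝 0)) (hv : Tendsto v atTop (𝓝 v₀))
    (hY : ∀ n, ((Y n).1 - (P.G (xs + t n • v n)).1).PosSemidef)
    (hr : Tendsto r atTop atTop) (hr0 : ∀ n, 0 < r n)
    (hlt : ∀ n, P.augTerm lam (r n) (xs + t n • v n) (Y n) < P.f₀ xs) : v₀ = 0 := by
  obtain ⟨hM, hMA, hcrit⟩ := id hkkt
  set M := lam.1.1 with hMdef
  set T := fderiv ℝ (fderiv ℝ fun y => P.lagrangian y lam) xs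
  set x := fun n => xs + t n • v n
  set D := P.dirG xs v₀
  -- `q` and `s` are the second order quotients of the Lagrangian and of `μ • (Y - G x)`,
  -- while `Z` and `w` are the first order quotients of `Y` and `h`.
  set q := fun n => (P.lagrangian (x n) lam - P.lagrangian xs lam) / t n ^ 2 with hq
  set Z : ℕ → SymMat m := fun n => (t n)⁻¹ • Y n with hZ
  set w := fun n => (t n)⁻¹ • P.h (x n) with hw
  set s := fun n => frobInner M ((Y n).1 - (P.G (x n)).1) / t n ^ 2 with hs
  have htne : ∀ n, t n ≠ 0 := fun n => (ht n).ne'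
  have hqlim : Tendsto q atTop (𝓝 (1 / 2 * T v₀ v₀)) :=
    tendsto_second_order_quotient (twiceDiffAt_lagrangian hd lam) hcrit ht ht0 hv
  have hs0 : ∀ n, 0 ≤ s n := fun n => div_nonneg (trace_mul_nonneg hM (hY n)) (sq_nonneg _)
  have hkey : ∀ n, q n + s n + r n / 2 * (frobInner (Z n).1 (Z n).1 + ‖w n‖ ^ 2) < 0 := by
    intro n
    have h1 := hlt n
    rw [augTerm_eq_lagrangian, ← lagrangian_eq_of_kkt hxs hkkt] at h1
    have h2 : q n + s n + r n / 2 * (frobInner (Z n).1 (Z n).1 + ‖w n‖ ^ 2)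
        = (P.lagrangian (x n) lam + frobInner M ((Y n).1 - (P.G (x n)).1)
          + r n / 2 * (frobInner (Y n).1 (Y n).1 + ‖P.h (x n)‖ ^ 2) - P.lagrangian xs lam)
            / t n ^ 2 := by
      simp only [hq, hs, hZ, hw, norm_smul, frobInner, Submodule.coe_smul, Matrix.smul_mul,
        Matrix.mul_smul, Matrix.trace_smul, smul_eq_mul, norm_inv, Real.norm_eq_abs, mul_pow,
        inv_pow, sq_abs]
      field_simp [htne n]
      ring
    rw [h2]
    exact div_neg_of_neg_of_pos (by linarith) (pow_pos (ht n) 2)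
  have hZ0 : ∀ n, 0 ≤ frobInner (Z n).1 (Z n).1 := fun n => frobInner_self_nonneg _
  -- The penalty terms are `O(t²)` and `r → ∞`, hence `Y = o(t)` and `h = o(t)`.
  have hpen : Tendsto (fun n => frobInner (Z n).1 (Z n).1 + ‖w n‖ ^ 2) atTop (𝓝 0) := by
    have h1 : Tendsto (fun n => -2 * q n / r n) atTop (𝓝 0) :=
      (hqlim.const_mul (-2)).div_atTop hr
    refine squeeze_zero (fun n => add_nonneg (hZ0 n) (sq_nonneg _)) (fun n => ?_) h1
    rw [le_div_iff₀ (hr0 n)]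
    linarith [hkey n, hs0 n]
  have hZlim : Tendsto (fun n => (Z n).1) atTop (𝓝 0) :=
    tendsto_zero_of_frobInner_self (squeeze_zero hZ0
      (fun n => le_add_of_nonneg_right (sq_nonneg _)) hpen)
  have hwlim : Tendsto w atTop (𝓝 0) := by
    have h1 : Tendsto (fun n => ‖w n‖ ^ 2) atTop (𝓝 0) :=
      squeeze_zero (fun n => sq_nonneg _) (fun n => le_add_of_nonneg_left (hZ0 n)) hpen
    rw [tendsto_zero_iff_norm_tendsto_zero]
    simpa using h1.sqrt
  have hGlim := tendsto_G_quotient hd ht ht0 hv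
  set B : ℕ → Matrix (Fin m) (Fin m) ℝ :=
    fun n => (Z n).1 - (t n)⁻¹ • ((P.G (x n)).1 - (P.G xs).1) with hB
  have hBlim : Tendsto B atTop (𝓝 (-D)) := by
    have := hZlim.sub hGlim
    rwa [zero_sub] at this
  have hSB : ∀ n, (Y n).1 - (P.G (x n)).1 = -(P.G xs).1 + t n • B n := by
    intro n
    simp only [hB, hZ, Submodule.coe_smul, smul_sub, smul_smul, mul_inv_cancel₀ (htne n), one_smul]
    abel
  have hMS : ∀ n, frobInner M (-(P.G xs).1 + t n • B n) = t n * frobInner M (B n) := by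
    intro n
    simp [frobInner, Matrix.mul_add, hMA]
  have hMBlim : Tendsto (fun n => frobInner M (B n)) atTop (𝓝 (-frobInner M D)) := by
    have := ((continuous_frobInner_right M).tendsto (-D)).comp hBlim
    simpa [frobInner, Function.comp_def] using this
  -- The limit direction lies in the critical cone.
  have hMD : frobInner M D = 0 := by
    have h1 : Tendsto (fun n => frobInner M (B n)) atTop (𝓝 0) := by
      have h2 : Tendsto (fun n => t n * (-q n)) atTop (𝓝 0) := by
        simpa using ht0.mul hqlim.neg
      have h3 : ∀ n, frobInner M (B n) = t n * s n := by
        intro n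
        have := htne n
        simp only [hs, hSB, hMS]
        field_simp
      refine squeeze_zero (fun n => ?_) (fun n => ?_) h2
      · rw [h3]
        exact mul_nonneg (ht n).le (hs0 n)
      · rw [h3]
        refine mul_le_mul_of_nonneg_left ?_ (ht n).le
        have : 0 ≤ r n / 2 * (frobInner (Z n).1 (Z n).1 + ‖w n‖ ^ 2) :=
          mul_nonneg (half_pos (hr0 n)).le (add_nonneg (hZ0 n) (sq_nonneg _))
        linarith [hkey n]
    have := tendsto_nhds_unique h1 hMBlim
    linarith
  have hhD : fderiv ℝ P.h xs v₀ = 0 := by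
    have h1 := tendsto_first_order_quotient hd.2.2.differentiableAt ht ht0 hv
    simp only [hxs, sub_zero] at h1
    exact tendsto_nhds_unique h1 hwlim
  have hfD : fderiv ℝ P.f₀ xs v₀ = 0 := by
    have h1 := tendsto_first_order_quotient hd.1.differentiableAt ht ht0 hv
    have h2 : Tendsto (fun n => t n * q n - frobInner M ((t n)⁻¹ • ((P.G (x n)).1 - (P.G xs).1))
        - inner ℝ lam.2 (w n)) atTop (𝓝 (0 * (1 / 2 * T v₀ v₀) - frobInner M D
          - inner ℝ lam.2 0)) :=
      ((ht0.mul hqlim).sub (((continuous_frobInner_right M).tendsto D).comp hGlim)).sub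
        (tendsto_const_nhds.inner hwlim)
    rw [hMD, inner_zero_right, zero_mul, sub_zero, sub_zero] at h2
    refine tendsto_nhds_unique (h1.congr fun n => ?_) h2
    have := htne n
    simp only [hq, hw, lagrangian, hxs, inner_smul_right, inner_zero_right, frobInner,
      Matrix.mul_smul, Matrix.mul_sub, Matrix.trace_smul, Matrix.trace_sub, smul_eq_mul, ← hMdef]
    field_simp
    simp only [x]
    ring
  have hcone : v₀ ∈ P.criticalCone xs := by
    refine criticalCone_iff.2 ⟨?_, hhD, hfD⟩
    set E := nullEigMat (P.G xs)
    have hc : Continuous fun X : Matrix (Fin m) (Fin m) ℝ => Eᵀ * X * E := by fun_prop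
    have h1 := (hc.tendsto (-D)).comp hBlim
    rw [Matrix.mul_neg, Matrix.neg_mul] at h1
    refine posSemidef_of_tendsto (fun n => ?_) h1
    have h2 := (hY n).conjTranspose_mul_mul_same E
    rw [hSB, Matrix.conjTranspose_eq_transpose_of_trivial, Matrix.mul_add, Matrix.add_mul,
      Matrix.mul_neg, Matrix.neg_mul, Matrix.mul_assoc Eᵀ (P.G xs).1, mul_nullEigMat,
      Matrix.mul_zero, neg_zero, zero_add, Matrix.mul_smul, Matrix.smul_mul] at h2
    have h3 := h2.smul (inv_nonneg.2 (ht n).le)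
    rwa [smul_smul, inv_mul_cancel₀ (htne n), one_smul] at h3
  -- The Schur complement estimate bounds `s` from below by the sigma term.
  have hschur : ∀ n, 0 ≤ s n - (frobInner M (D * pinv (P.G xs) * B n)
      + frobInner M (B n * pinv (P.G xs) * D) + frobInner M (D * pinv (P.G xs) * D))
      + t n * frobInner M (D * pinv (P.G xs) * B n * pinv (P.G xs) * D) := by
    intro n
    have h1 := schur_estimate (D := D) hM hMA (dirG_transpose xs v₀) (hSB n ▸ hY n)
    rw [← hSB n] at h1
    refine (div_nonneg h1 (sq_nonneg (t n))).trans_eq ?_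
    have := htne n
    simp only [hs]
    field_simp
  set K := frobInner M (D * pinv (P.G xs) * D) with hK
  have hlim : Tendsto (fun n => -q n - (frobInner M (D * pinv (P.G xs) * B n)
      + frobInner M (B n * pinv (P.G xs) * D) + K)
      + t n * frobInner M (D * pinv (P.G xs) * B n * pinv (P.G xs) * D)) atTop
      (𝓝 (-(1 / 2 * T v₀ v₀) - (-K + -K + K) + 0)) := by
    have c1 : Continuous fun X => frobInner M (D * pinv (P.G xs) * X) := by
      unfold frobInner; fun_prop
    have c2 : Continuous fun X => frobInner M (X * pinv (P.G xs) * D) := by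
      unfold frobInner; fun_prop
    have c3 : Continuous fun X => frobInner M (D * pinv (P.G xs) * X * pinv (P.G xs) * D) := by
      unfold frobInner; fun_prop
    have l1 := (c1.tendsto (-D)).comp hBlim
    have l2 := (c2.tendsto (-D)).comp hBlim
    have l3 := ht0.mul ((c3.tendsto (-D)).comp hBlim)
    have e1 : frobInner M (D * pinv (P.G xs) * -D) = -K := by simp [hK, frobInner]
    have e2 : frobInner M (-D * pinv (P.G xs) * D) = -K := by simp [hK, frobInner]
    rw [e1] at l1
    rw [e2] at l2
    rw [zero_mul] at l3
    exact (hqlim.neg.sub ((l1.add l2).add_const K)).add l3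
  have hfinal : 0 ≤ -(1 / 2 * T v₀ v₀) - (-K + -K + K) + 0 := by
    refine ge_of_tendsto' hlim fun n => ?_
    have : 0 ≤ r n / 2 * (frobInner (Z n).1 (Z n).1 + ‖w n‖ ^ 2) :=
      mul_nonneg (half_pos (hr0 n)).le (add_nonneg (hZ0 n) (sq_nonneg _))
    linarith [hkey n, hschur n]
  by_contra hne
  have hpos := hsosc v₀ hcone hne
  rw [secondOrder_quadForm] at hpos
  linarith

/-- Local augmented duality, in sequential form: near a solution satisfying the second order
sufficient condition, and for large penalty parameters, `augTerm` does not fall below the optimal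
value. -/
theorem no_descent_sequence {xs : EuclideanSpace ℝ (Fin d)} (hxs : P.h xs = 0)
    (hd : P.TwiceDiffAt xs) {lam : Param m l} (hkkt : P.IsKKTPair xs lam)
    (hsosc : P.SecondOrderSufficient xs lam)
    {x : ℕ → EuclideanSpace ℝ (Fin d)} {Y : ℕ → SymMat m} {r : ℕ → ℝ}
    (hx : Tendsto x atTop (𝓝 xs))
    (hY : ∀ n, ((Y n).1 - (P.G (x n)).1).PosSemidef)
    (hr : Tendsto r atTop atTop) (hr0 : ∀ n, 0 < r n)
    (hlt : ∀ n, P.augTerm lam (r n) (x n) (Y n) < P.f₀ xs) : False := by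
  have hne : ∀ n, 0 < ‖x n - xs‖ := by
    intro n
    rw [norm_pos_iff, sub_ne_zero]
    intro h
    have h1 := hlt n
    have h2 := hY n
    rw [h] at h1 h2
    rw [augTerm_eq_lagrangian, lagrangian_eq_of_kkt hxs hkkt] at h1
    have h3 : 0 ≤ frobInner lam.1.1 ((Y n).1 - (P.G xs).1) := trace_mul_nonneg hkkt.1 h2
    have h4 : 0 ≤ r n / 2 * (frobInner (Y n).1 (Y n).1 + ‖P.h xs‖ ^ 2) :=
      mul_nonneg (half_pos (hr0 n)).le (add_nonneg (frobInner_self_nonneg _) (sq_nonneg _))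
    linarith
  have hsphere : ∀ n, ‖x n - xs‖⁻¹ • (x n - xs) ∈
      Metric.sphere (0 : EuclideanSpace ℝ (Fin d)) 1 := by
    intro n
    rw [mem_sphere_zero_iff_norm, norm_smul, norm_inv, norm_norm, inv_mul_cancel₀ (hne n).ne']
  obtain ⟨v₀, hv₀, φ, hφ, hlim⟩ := (isCompact_sphere _ _).tendsto_subseq hsphere
  have hxeq : ∀ n, xs + ‖x n - xs‖ • (‖x n - xs‖⁻¹ • (x n - xs)) = x n := by
    intro n
    rw [smul_smul, mul_inv_cancel₀ (hne n).ne', one_smul, add_sub_cancel]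
  have ht0 : Tendsto (fun n => ‖x n - xs‖) atTop (𝓝 0) :=
    tendsto_iff_norm_sub_tendsto_zero.1 hx
  have hzero : v₀ = 0 := eq_zero_of_descent_direction hxs hd hkkt hsosc
    (t := fun n => ‖x (φ n) - xs‖) (v := fun n => ‖x (φ n) - xs‖⁻¹ • (x (φ n) - xs))
    (Y := fun n => Y (φ n)) (r := fun n => r (φ n))
    (fun n => hne _) (ht0.comp hφ.tendsto_atTop) hlim
    (fun n => by rw [hxeq]; exact hY _) (hr.comp hφ.tendsto_atTop) (fun n => hr0 _)
    (fun n => by rw [hxeq]; exact hlt _)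
  rw [hzero, mem_sphere_zero_iff_norm, norm_zero] at hv₀
  exact zero_ne_one hv₀

/-! ### Limits of infeasible points -/

/-- A cluster point of points whose perturbations vanish and whose `augTerm` values stay below the
optimal value is optimal. -/
theorem mem_solutions_of_tendsto (hf₀ : LowerSemicontinuous P.f₀) (hG : Continuous P.G)
    (hh : Continuous P.h) {xs : EuclideanSpace ℝ (Fin d)} (hxs : xs ∈ P.solutions)
    {lam : Param m l} {x : ℕ → EuclideanSpace ℝ (Fin d)} {Y : ℕ → SymMat m} {r : ℕ → ℝ}
    {a : EuclideanSpace ℝ (Fin d)} (hx : Tendsto x atTop (𝓝 a))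
    (hY : ∀ n, ((Y n).1 - (P.G (x n)).1).PosSemidef) (hr0 : ∀ n, 0 < r n)
    (hlt : ∀ n, P.augTerm lam (r n) (x n) (Y n) < P.f₀ xs)
    (hpen : Tendsto (fun n => frobInner (Y n).1 (Y n).1 + ‖P.h (x n)‖ ^ 2) atTop (𝓝 0)) :
    a ∈ P.solutions := by
  have hY0 : ∀ n, 0 ≤ frobInner (Y n).1 (Y n).1 := fun n => frobInner_self_nonneg _
  have hYlim : Tendsto (fun n => (Y n).1) atTop (𝓝 0) :=
    tendsto_zero_of_frobInner_self (squeeze_zero hY0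
      (fun n => le_add_of_nonneg_right (sq_nonneg _)) hpen)
  have hhlim : Tendsto (fun n => P.h (x n)) atTop (𝓝 0) := by
    have h1 : Tendsto (fun n => ‖P.h (x n)‖ ^ 2) atTop (𝓝 0) :=
      squeeze_zero (fun n => sq_nonneg _) (fun n => le_add_of_nonneg_left (hY0 n)) hpen
    rw [tendsto_zero_iff_norm_tendsto_zero]
    simpa using h1.sqrt
  have hfeas : a ∈ P.feasible := by
    refine ⟨?_, tendsto_nhds_unique ((hh.tendsto a).comp hx) hhlim⟩
    have h1 : Tendsto (fun n => (P.G (x n)).1) atTop (𝓝 (P.G a).1) :=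
      ((continuous_subtype_val.comp hG).tendsto a).comp hx
    have h2 := hYlim.sub h1
    rw [zero_sub] at h2
    exact posSemidef_of_tendsto hY h2
  have hle : P.f₀ a ≤ P.f₀ xs := by
    by_contra! hgt
    obtain ⟨y, hy1, hy2⟩ := exists_between hgt
    have h1 : Tendsto (fun n => P.f₀ xs - frobInner lam.1.1 (Y n).1 - inner ℝ lam.2 (P.h (x n)))
        atTop (𝓝 (P.f₀ xs - frobInner lam.1.1 0 - inner ℝ lam.2 0)) :=
      (tendsto_const_nhds.sub (((continuous_frobInner_right lam.1.1).tendsto 0).comp hYlim)).sub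
        (tendsto_const_nhds.inner hhlim)
    have h2 : P.f₀ xs - frobInner lam.1.1 0 - inner ℝ lam.2 0 = P.f₀ xs := by simp [frobInner]
    rw [h2] at h1
    refine hy1.not_ge (ge_of_tendsto h1 ?_)
    filter_upwards [hx.eventually (hf₀ a y hy2)] with n hn
    have h3 := hlt n
    have h4 : 0 ≤ r n / 2 * (frobInner (Y n).1 (Y n).1 + ‖P.h (x n)‖ ^ 2) :=
      mul_nonneg (half_pos (hr0 n)).le (add_nonneg (hY0 n) (sq_nonneg _))
    unfold augTerm at h3
    linarith
  exact ⟨hfeas, fun y hy => hle.trans (hxs.2 y hy)⟩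

end Problem

end NSDP

theorem mainTheorem6 {d m l : ℕ} (P : NSDP.Problem d m l)
    (hf₀ : LowerSemicontinuous P.f₀) (hG : Continuous P.G) (hh : Continuous P.h)
    (hne : P.solutions.Nonempty)
    (hdiff : ∀ x ∈ P.solutions, P.TwiceDiffAt x)
    (lam : NSDP.Param m l)
    (hkkt : ∀ x ∈ P.solutions, P.IsKKTPair x lam ∧ P.SecondOrderSufficient x lam) :
    P.IsAugLagrangeMultiplier lam ↔
      ∃ r₀ : ℝ, 0 < r₀ ∧ ∃ δ : ℝ, 0 < δ ∧
        (∃ c : ℝ, ∀ x, (c : EReal) ≤ P.augLagrangian x lam r₀) ∧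
        (Bornology.IsBounded
            {x | P.augLagrangian x lam r₀ < P.optimalValue ∧ P.penalty x < δ} ∨
          {x | P.augLagrangian x lam r₀ < P.optimalValue ∧ P.penalty x < δ} = ∅) := by
  obtain ⟨xs, hxs⟩ := hne
  rw [NSDP.Problem.isAugLagrangeMultiplier_iff hxs, NSDP.Problem.optimalValue_eq hxs]
  constructor
  · rintro ⟨r, hr, H⟩
    have hbound : ∀ x, ((P.f₀ xs : ℝ) : EReal) ≤ P.augLagrangian x lam (r + 1) := fun x =>
      NSDP.Problem.le_augLagrangian_iff.2 fun Y hY =>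
        (H x Y hY).trans (NSDP.Problem.augTerm_mono (by linarith) x Y)
    exact ⟨r + 1, by linarith, 1, one_pos, ⟨P.f₀ xs, hbound⟩,
      .inr (Set.eq_empty_of_forall_notMem fun x hx => (hbound x).not_gt hx.1)⟩
  · rintro ⟨r₀, hr₀, δ, hδ, ⟨c, hc⟩, hset⟩
    have hbdd : Bornology.IsBounded
        {x | P.augLagrangian x lam r₀ < (P.f₀ xs : EReal) ∧ P.penalty x < δ} :=
      hset.elim id fun h => h ▸ Bornology.isBounded_empty
    by_contra! hcon
    -- For each of the penalty parameters `r₀ + n + 1` the multiplier inequality fails somewhere.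
    have hpos : ∀ n : ℕ, 0 < r₀ + (n + 1 : ℝ) := fun n => by positivity
    choose x Y hY hlt using fun n : ℕ => hcon (r₀ + (n + 1)) (hpos n).le
    have hpen : Tendsto
        (fun n => NSDP.frobInner (Y n).1 (Y n).1 + ‖P.h (x n)‖ ^ 2) atTop (𝓝 0) := by
      have h1 : Tendsto (fun n : ℕ => 2 * (P.f₀ xs - c) / ((n : ℝ) + 1)) atTop (𝓝 0) :=
        tendsto_const_nhds.div_atTop
          (tendsto_atTop_add_const_right _ _ tendsto_natCast_atTop_atTop)
      refine squeeze_zero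
        (fun n => add_nonneg (NSDP.frobInner_self_nonneg _) (sq_nonneg _)) (fun n => ?_) h1
      have h2 := NSDP.Problem.le_augLagrangian_iff.1 (hc (x n)) (Y n) (hY n)
      have h3 := hlt n
      rw [NSDP.Problem.augTerm_eq_add lam r₀] at h3
      rw [le_div_iff₀ (by positivity)]
      linarith
    have hmem : ∀ᶠ n in atTop, x n ∈
        {x | P.augLagrangian x lam r₀ < (P.f₀ xs : EReal) ∧ P.penalty x < δ} := by
      filter_upwards [hpen.eventually (gt_mem_nhds hδ)] with n hn
      exact ⟨NSDP.Problem.augLagrangian_lt_iff.2 ⟨Y n, hY n,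
        (NSDP.Problem.augTerm_mono (by linarith [n.cast_nonneg (α := ℝ)]) _ _).trans_lt (hlt n)⟩,
        (NSDP.Problem.penalty_le (hY n)).trans_lt hn⟩
    obtain ⟨a, -, φ, hφ, ha⟩ := tendsto_subseq_of_frequently_bounded hbdd hmem.frequently
    have hasol : a ∈ P.solutions :=
      NSDP.Problem.mem_solutions_of_tendsto hf₀ hG hh hxs ha (fun n => hY (φ n))
        (fun n => hpos (φ n)) (fun n => hlt (φ n)) (hpen.comp hφ.tendsto_atTop)
    have hval : P.f₀ xs = P.f₀ a := le_antisymm (hxs.2 a hasol.1) (hasol.2 xs hxs.1)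
    have hr : Tendsto (fun n : ℕ => r₀ + ((n : ℝ) + 1)) atTop atTop :=
      tendsto_atTop_add_const_left _ _
        (tendsto_atTop_add_const_right _ _ tendsto_natCast_atTop_atTop)
    exact NSDP.Problem.no_descent_sequence hasol.1.2 (hdiff a hasol) (hkkt a hasol).1
      (hkkt a hasol).2 ha (fun n => hY (φ n)) (hr.comp hφ.tendsto_atTop) (fun n => hpos (φ n))
      (fun n => hval ▸ hlt (φ n))
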